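/- Let $E$ be a separable real Banach space (for example $\mathbb{R}^n$, or a finite-dimensional space of symmetric tensors), and let $\{X_\tau\}_{\tau\ge 0}$ be an $E$-valued stochastic process on a probability space $(\Omega,\mathcal F,\mathbb P)$ such that: (i) $X$ has stationary independent increments: for all $0\le\tau_0\le\tau_1\le\dots\le\tau_n$ the increments $X_{\tau_1}-X_{\tau_0},\dots,X_{\tau_n}-X_{\tau_{n-1}}$ are mutually independent, and the law of $X_{\tau+s}-X_\tau$ depends only on $s$; (ii) almost all sample paths $\tau\mapsto X_\tau$ are continuous in the norm topology of $E$. Then there are a drift vector $b\in E$ and a symmetric positive semidefinite continuous bilinear form $A$ on the dual $E^*$ (for $E=\mathbb{R}^n$, a positive semidefinite matrix) such that $X_\tau-X_0$ is a Gaussian process (all its finite-dimensional distributions are Gaussian) with finite second moments, mean $\mathbb E[X_\tau-X_0]=\tau b$, and covariance $$\operatorname{Cov}\bigl(L(X_\sigma-X_0),\,M(X_\tau-X_0)\bigr)=\min(\sigma,\tau)\,A(L,M)\qquad(\sigma,\tau\ge 0,\ L,M\in E^*),$$ so that the covariance of $X_\tau-X_0$ is $\tau A$. Moreover $X_\tau=X_0+\tau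 b+W_\tau$, where $W$ is an $E$-valued Wiener process with covariance $A$: $W_0=0$ almost surely, $W_t-W_s\sim\mathcal N(0,(t-s)A)$ for $0\le s\le t$, increments of $W$ over successive intervals are mutually independent, and almost all paths of $W$ are continuous. That is, $X$ is a Wiener process with drift. -/

import Mathlib

open MeasureTheory ProbabilityTheory
open scoped NNReal

/-- The process `X` has stationary increments: the law of `X (τ + s) - X τ` depends only
on the lag `s`. -/
def HasStationaryIncrements {Ω E : Type*} [MeasurableSpace Ω] [MeasurableSpace E] [Sub E]
    (X : ℝ≥0 → Ω → E) (P : Measure Ω) : Prop :=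
  ∀ s τ τ' : ℝ≥0, IdentDistrib (fun ω ↦ X (τ + s) ω - X τ ω) (fun ω ↦ X (τ' + s) ω - X τ' ω) P P

/-- `W` is a (centred) Wiener process with values in `E` and covariance `A`, where `A` is a
symmetric positive semidefinite continuous bilinear form on the dual of `E` (for `E = ℝⁿ`, a
positive semidefinite matrix): it starts at `0`, `W t - W s` has law `N(0, (t - s) A)`, the
increments over successive intervals are independent, and almost all paths are continuous. -/
structure IsWienerProcess {Ω E : Type*} [MeasurableSpace Ω]
    [NormedAddCommGroup E] [NormedSpace ℝ E] [MeasurableSpace E] [BorelSpace E]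
    (W : ℝ≥0 → Ω → E) (A : StrongDual ℝ E →L[ℝ] StrongDual ℝ E →L[ℝ] ℝ)
    (P : Measure Ω) : Prop where
  posSemidef : A.toBilinForm.IsPosSemidef
  zero : ∀ᵐ ω ∂P, W 0 ω = 0
  gaussian_increments : ∀ s t : ℝ≥0, s ≤ t → HasGaussianLaw (fun ω ↦ W t ω - W s ω) P
  mean_increments : ∀ s t : ℝ≥0, s ≤ t → ∫ ω, (W t ω - W s ω) ∂P = 0
  covariance_increments : ∀ s t : ℝ≥0, s ≤ t →
    covarianceBilinDual (P.map (fun ω ↦ W t ω - W s ω)) = ((t : ℝ) - (s : ℝ)) • A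
  independent_increments : HasIndepIncrements W P
  continuous_paths : ∀ᵐ ω ∂P, Continuous (fun t ↦ W t ω)

/-!
Continuity of the paths forces the increments to be Gaussian. For a real process `Y` with
stationary independent increments, the characteristic function of `Y τ - Y 0` at `t` is
multiplicative and continuous in `τ`, hence equal to `exp (τ ψ(t))` for some exponent `ψ(t)`
(`NNReal.exists_eq_exp_of_continuous_of_map_add`), and `ψ` is the limit of `n (φₙ - 1)`, where `φₙ`
is the characteristic function of the law `μₙ` of `Y (1 / n) - Y 0`. Uniform continuity of the paths
on `[0, 1]` makes the largest of the `n` increments of step `1 / n` tend to zero, and independence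
turns this into `n μₙ {|x| > ε} → 0` (`tendsto_mul_measureReal_increment_gt`).

So `ψ` has no jump part. Indeed, the function
`h_t(x) = exp (t x I) - 1 - t sin x I + t² (1 - cos x)` is bounded and is `o(1 - cos x)` at `0`, while
`n ∫ (1 - cos x) dμₙ` converges to `-Re ψ(1)`; hence `n ∫ h_t dμₙ → 0`, which reads
`ψ(t) = t Im ψ(1) I + t² Re ψ(1)` (`eq_linear_add_quadratic_of_tendsto_charFun`). This is the exponent
of a Gaussian law whose mean and variance are proportional to `τ`
(`exists_map_increment_eq_gaussianReal`).

In a Banach space, continuous linear functionals reduce Gaussianity of the increments to the real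
case. Fernique's theorem then provides the moments, so that the drift and the covariance are those
of `X 1 - X 0`; proportionality to time passes from functionals to the mean because the dual
separates points, and to the covariance by polarization. Independence of the increments gives joint
Gaussianity and the factor `min σ τ`.
-/

/-! ### Continuous one-parameter semigroups of complex numbers -/

open Filter Topology Complex in
/-- A continuous homomorphism from `(ℝ≥0, +)` to `(ℂ, *)` is an exponential. Averaging over
`[0, a]` shows that it is differentiable, and then it solves a linear differential equation. -/
lemma NNReal.exists_eq_exp_of_continuous_of_map_add {f : ℝ≥0 → ℂ} (hf : Continuous f)
    (h0 : f 0 = 1) (hmul : ∀ s t, f (s + t) = f s * f t) :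
    ∃ c : ℂ, ∀ s : ℝ≥0, f s = exp (s * c) := by
  set g : ℝ → ℂ := fun x ↦ f x.toNNReal with hg_def
  have hg : Continuous g := by fun_prop
  have hg0 : g 0 = 1 := by simp [hg_def, h0]
  have hgmul : ∀ s t : ℝ, 0 ≤ s → 0 ≤ t → g (s + t) = g s * g t := fun s t hs ht ↦ by
    simp only [hg_def, Real.toNNReal_add hs ht, hmul]
  set F : ℝ → ℂ := fun x ↦ ∫ u in (0 : ℝ)..x, g u with hF_def
  have hF : ∀ x, HasDerivAt F (g x) x := fun x ↦ hg.integral_hasStrictDerivAt 0 x |>.hasDerivAt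
  obtain ⟨a, haF, ha⟩ : ∃ a, F a ≠ 0 ∧ 0 < a := by
    have h1 : ∀ᶠ z in 𝓝[≠] (0 : ℝ), F z ≠ 0 :=
      (hF 0).eventually_ne (by rw [hg0]; exact one_ne_zero)
    have h2 : ∀ᶠ z in 𝓝[>] (0 : ℝ), F z ≠ 0 :=
      h1.filter_mono (nhdsWithin_mono _ fun x hx ↦ ne_of_gt hx)
    exact (h2.and self_mem_nhdsWithin).exists
  -- integrate `g (s + u) = g s * g u` over `u ∈ [0, a]`
  have hshift : ∀ s : ℝ, 0 ≤ s → g s = (F (s + a) - F s) / F a := by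
    intro s hs
    rw [eq_div_iff haF]
    have h1 : F (s + a) - F s = ∫ u in s..(s + a), g u :=
      intervalIntegral.integral_interval_sub_left (hg.intervalIntegrable _ _)
        (hg.intervalIntegrable _ _)
    have h2 : ∫ u in s..(s + a), g u = ∫ u in (0 : ℝ)..a, g (s + u) := by
      rw [intervalIntegral.integral_comp_add_left, add_zero]
    rw [h1, h2, hF_def, ← intervalIntegral.integral_const_mul]
    refine intervalIntegral.integral_congr fun u hu ↦ ?_
    rw [Set.uIcc_of_le ha.le] at hu
    exact (hgmul s u hs hu.1).symm
  set c : ℂ := (g a - 1) / F a with hc_def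
  set H : ℝ → ℂ := fun x ↦ (F (x + a) - F x) / F a * exp (-(x * c)) with hH_def
  have hHderiv : ∀ x : ℝ, 0 ≤ x → HasDerivAt H 0 x := by
    intro x hx
    have h1 : HasDerivAt (fun x ↦ (F (x + a) - F x) / F a) ((g (x + a) - g x) / F a) x :=
      (((hF (x + a)).comp_add_const x a).sub (hF x)).div_const _
    have h2 : HasDerivAt (fun x : ℝ ↦ exp (-(x * c))) (exp (-(x * c)) * -(1 * c)) x :=
      (((Complex.ofRealCLM.hasDerivAt (x := x)).mul_const c).neg).cexp
    refine (h1.mul h2).congr_deriv ?_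
    change (g (x + a) - g x) / F a * exp (-(x * c))
      + (F (x + a) - F x) / F a * (exp (-(x * c)) * -(1 * c)) = 0
    rw [← hshift x hx, hgmul x a hx ha.le, hc_def]
    ring
  refine ⟨c, fun s ↦ ?_⟩
  have hconst : H s = H 0 :=
    constant_of_has_deriv_right_zero (a := 0) (b := (s : ℝ))
      (fun x hx ↦ (hHderiv x hx.1).continuousAt.continuousWithinAt)
      (fun x hx ↦ (hHderiv x hx.1).hasDerivWithinAt) s ⟨s.2, le_rfl⟩
  simp only [hH_def] at hconst
  rw [← hshift s s.2, ← hshift 0 le_rfl, hg0] at hconst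
  have hfs : g s = f s := by simp [hg_def]
  rw [hfs] at hconst
  simpa [← mul_assoc, Complex.exp_neg, mul_inv_eq_one₀ (Complex.exp_ne_zero _)] using hconst

/-! ### Lévy exponents without a jump part -/

open Complex in
/-- The quadratic `1 - cos x` dominates, near `0`, what remains of `exp (t x I) - 1` after
subtraction of its first two Taylor terms, written with the bounded functions `sin` and
`1 - cos`. -/
lemma exists_norm_exp_sub_le_mul_one_sub_cos (t : ℝ) {η : ℝ} (hη : 0 < η) :
    ∃ δ > 0, ∀ x : ℝ, |x| ≤ δ →
      ‖exp (t * x * I) - 1 - t * Real.sin x * I + t ^ 2 * (1 - Real.cos x)‖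
        ≤ η * (1 - Real.cos x) := by
  set K : ℝ := |t| ^ 3 + |t| + t ^ 2 with hK
  have hK0 : 0 ≤ K := by positivity
  refine ⟨min (1 / (1 + |t|)) (η / (5 * K + 1)), by positivity, fun x hx ↦ ?_⟩
  have hx1 : |x| ≤ 1 / (1 + |t|) := hx.trans (min_le_left _ _)
  have hx2 : |x| ≤ η / (5 * K + 1) := hx.trans (min_le_right _ _)
  have hxle : |x| ≤ 1 := hx1.trans (by rw [div_le_one (by positivity)]; simp)
  have htx : |t| * |x| ≤ 1 := by
    rw [le_div_iff₀ (by positivity)] at hx1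
    nlinarith [abs_nonneg x]
  have hx0 := abs_nonneg x
  have hx3 : |x| ^ 4 ≤ |x| ^ 3 := pow_le_pow_of_le_one hx0 hxle (by norm_num)
  have hexp : ‖exp (t * x * I) - (1 + t * x * I + (t * x * I) ^ 2 / 2)‖ ≤ (|t| * |x|) ^ 3 := by
    have hn : ‖(t * x * I : ℂ)‖ = |t| * |x| := by simp
    have := Complex.exp_bound (x := t * x * I) (by rw [hn]; exact htx) (n := 3) (by norm_num)
    rw [hn] at this
    simp only [Finset.sum_range_succ, Finset.sum_range_zero, Nat.factorial] at this
    refine le_trans (le_of_eq ?_) (this.trans ?_)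
    · congr 1; push_cast; ring
    · have : 0 ≤ (|t| * |x|) ^ 3 := by positivity
      norm_num
      linarith
  have hsin : |Real.sin x - x| ≤ |x| ^ 3 := by
    have h1 := Real.sin_bound hxle
    have h2 : |x ^ 3 / 6| ≤ |x| ^ 3 / 6 := by rw [abs_div, abs_pow]; norm_num
    have : Real.sin x - x = (Real.sin x - (x - x ^ 3 / 6)) - x ^ 3 / 6 := by ring
    rw [this]
    refine (abs_sub _ _).trans ?_
    have : 0 ≤ |x| ^ 3 := by positivity
    have : |x| ^ 5 ≤ |x| ^ 3 := pow_le_pow_of_le_one hx0 hxle (by norm_num)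
    linarith
  have hcos : |1 - Real.cos x - x ^ 2 / 2| ≤ |x| ^ 3 := by
    have h1 := Real.cos_bound hxle
    rw [abs_sub_comm] at h1
    have h3 : 0 ≤ |x| ^ 3 := by positivity
    rw [show 1 - Real.cos x - x ^ 2 / 2 = 1 - x ^ 2 / 2 - Real.cos x by ring]
    linarith
  have hquad : x ^ 2 ≤ 5 * (1 - Real.cos x) := by
    have h1 := (abs_le.1 (Real.cos_bound hxle)).2
    have h3 : |x| ^ 4 ≤ x ^ 2 := by
      rw [← sq_abs x]; exact pow_le_pow_of_le_one hx0 hxle (by norm_num)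
    nlinarith [sq_nonneg x]
  have hsplit : exp (t * x * I) - 1 - t * Real.sin x * I + t ^ 2 * (1 - Real.cos x)
      = (exp (t * x * I) - (1 + t * x * I + (t * x * I) ^ 2 / 2))
        - ((t * (Real.sin x - x) : ℝ) : ℂ) * I
        + ((t ^ 2 * (1 - Real.cos x - x ^ 2 / 2) : ℝ) : ℂ) := by
    push_cast
    linear_combination ((t * x : ℂ) ^ 2 / 2) * Complex.I_sq
  calc ‖exp (t * x * I) - 1 - t * Real.sin x * I + t ^ 2 * (1 - Real.cos x)‖
      ≤ (|t| * |x|) ^ 3 + |t| * |x| ^ 3 + t ^ 2 * |x| ^ 3 := by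
        rw [hsplit]
        refine (norm_add_le _ _).trans (add_le_add ((norm_sub_le _ _).trans
          (add_le_add hexp ?_)) ?_)
        · rw [norm_mul, Complex.norm_I, mul_one, Complex.norm_real, Real.norm_eq_abs, abs_mul]
          gcongr
        · rw [Complex.norm_real, Real.norm_eq_abs, abs_mul, abs_of_nonneg (sq_nonneg t)]
          gcongr
    _ = K * |x| * x ^ 2 := by rw [hK, ← sq_abs x]; ring
    _ ≤ K * |x| * (5 * (1 - Real.cos x)) := by gcongr
    _ = (5 * K * |x|) * (1 - Real.cos x) := by ring
    _ ≤ η * (1 - Real.cos x) := by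
        gcongr
        · linarith [Real.cos_le_one x]
        · rw [le_div_iff₀ (by positivity)] at hx2
          nlinarith

open Filter Topology Complex in
/-- If rescaled small probability measures have no mass left away from the origin in the limit,
then the limit `ψ` of the rescaled characteristic functions is a Gaussian exponent: a linear term
plus a quadratic one. -/
lemma eq_linear_add_quadratic_of_tendsto_charFun {ι : Type*} {l : Filter ι} [l.NeBot]
    {μ : ι → Measure ℝ} [∀ i, IsProbabilityMeasure (μ i)] {c : ι → ℝ} (hc : ∀ i, 0 ≤ c i)
    {ψ : ℝ → ℂ} (hψ : ∀ t, Tendsto (fun i ↦ (c i : ℂ) * (charFun (μ i) t - 1)) l (𝓝 (ψ t)))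
    (hsmall : ∀ ε > 0, Tendsto (fun i ↦ c i * (μ i).real {x | ε < |x|}) l (𝓝 0)) (t : ℝ) :
    ψ t = t * (ψ 1).im * I + t ^ 2 * (ψ 1).re := by
  set h : ℝ → ℂ := fun x ↦
    exp (t * x * I) - 1 - t * Real.sin x * I + t ^ 2 * (1 - Real.cos x) with h_def
  have hint : ∀ i (s : ℝ), Integrable (fun x : ℝ ↦ exp (s * x * I)) (μ i) := fun i s ↦
    Integrable.of_bound (by fun_prop) 1 (ae_of_all _ fun x ↦ by
      rw [← ofReal_mul, norm_exp_ofReal_mul_I])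
  have hcosint : ∀ i, Integrable Real.cos (μ i) := fun i ↦
    Integrable.of_bound (by fun_prop) 1 (ae_of_all _ fun x ↦ Real.abs_cos_le_one x)
  have hsinint : ∀ i, Integrable Real.sin (μ i) := fun i ↦
    Integrable.of_bound (by fun_prop) 1 (ae_of_all _ fun x ↦ Real.abs_sin_le_one x)
  have hcosC : ∀ i, Integrable (fun x ↦ ((Real.cos x : ℝ) : ℂ)) (μ i) := fun i ↦ (hcosint i).ofReal
  have hsinC : ∀ i, Integrable (fun x ↦ ((Real.sin x : ℝ) : ℂ)) (μ i) := fun i ↦ (hsinint i).ofReal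
  have hexp : ∀ x : ℝ, exp ((1 : ℝ) * x * I) = Real.cos x + Real.sin x * I := fun x ↦ by
    rw [ofReal_one, one_mul, exp_mul_I, ofReal_cos, ofReal_sin]
  have hchar1 : ∀ i, charFun (μ i) 1 = (∫ x, Real.cos x ∂μ i : ℝ) + (∫ x, Real.sin x ∂μ i : ℝ) * I
      := fun i ↦ by
    rw [charFun_apply_real]
    simp_rw [hexp]
    rw [integral_add (hcosC i) ((hsinC i).mul_const I), integral_mul_const,
      integral_complex_ofReal, integral_complex_ofReal]
  have hre : ∀ i, ∫ x, Real.cos x ∂μ i = (charFun (μ i) 1).re := fun i ↦ by simp [hchar1]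
  have him : ∀ i, ∫ x, Real.sin x ∂μ i = (charFun (μ i) 1).im := fun i ↦ by simp [hchar1]
  have hinth : ∀ i, ∫ x, h x ∂μ i = (charFun (μ i) t - 1) - t * (charFun (μ i) 1).im * I
      + t ^ 2 * (1 - (charFun (μ i) 1).re) := fun i ↦ by
    simp only [h_def]
    rw [integral_add, integral_sub, integral_sub, integral_mul_const, integral_const_mul,
      integral_const_mul, integral_sub, integral_complex_ofReal, integral_complex_ofReal,
      ← charFun_apply_real, hre, him]
    · simp
    · exact integrable_const _
    · exact hcosC i
    · exact hint i t
    · exact integrable_const _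
    · exact (hint i t).sub (integrable_const _)
    · exact ((hsinC i).const_mul _).mul_const _
    · exact ((hint i t).sub (integrable_const _)).sub (((hsinC i).const_mul _).mul_const _)
    · exact ((integrable_const _).sub (hcosC i)).const_mul _
  have hlimre : Tendsto (fun i ↦ c i * (1 - (charFun (μ i) 1).re)) l (𝓝 (-(ψ 1).re)) := by
    have := ((Complex.continuous_re.tendsto _).comp (hψ 1)).neg
    refine this.congr fun i ↦ ?_
    simp
    ring
  have hlimim : Tendsto (fun i ↦ c i * (charFun (μ i) 1).im) l (𝓝 (ψ 1).im) := by
    have := ((Complex.continuous_im.tendsto _).comp (hψ 1))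
    refine this.congr fun i ↦ ?_
    simp
  set D : ℂ := ψ t - t * (ψ 1).im * I + t ^ 2 * (-(ψ 1).re : ℝ) with hD
  have hlim : Tendsto (fun i ↦ (c i : ℂ) * ∫ x, h x ∂μ i) l (𝓝 D) := by
    have h1 : Tendsto (fun i ↦ ((c i * (charFun (μ i) 1).im : ℝ) : ℂ)) l (𝓝 (ψ 1).im) :=
      (Complex.continuous_ofReal.tendsto _).comp hlimim
    have h2 : Tendsto (fun i ↦ ((c i * (1 - (charFun (μ i) 1).re) : ℝ) : ℂ)) l
        (𝓝 (-(ψ 1).re : ℝ)) := (Complex.continuous_ofReal.tendsto _).comp hlimre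
    refine (((hψ t).sub ((h1.const_mul (t : ℂ)).mul_const I)).add
      (h2.const_mul ((t : ℂ) ^ 2))).congr fun i ↦ ?_
    rw [hinth]
    push_cast
    ring
  set B : ℝ := 2 + |t| + 2 * t ^ 2 with hB
  have hhB : ∀ x, ‖h x‖ ≤ B := by
    intro x
    have e1 : ‖exp (t * x * I)‖ = 1 := by rw [← ofReal_mul, norm_exp_ofReal_mul_I]
    have e2 : ‖(t * Real.sin x * I : ℂ)‖ ≤ |t| := by
      rw [norm_mul, norm_mul, Complex.norm_I, mul_one, Complex.norm_real, Complex.norm_real]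
      exact mul_le_of_le_one_right (abs_nonneg t) (Real.abs_sin_le_one x)
    have e3 : ‖(t ^ 2 * (1 - Real.cos x) : ℂ)‖ ≤ 2 * t ^ 2 := by
      rw [norm_mul, norm_pow, Complex.norm_real, Real.norm_eq_abs, sq_abs, mul_comm]
      gcongr
      refine (norm_sub_le _ _).trans ?_
      rw [norm_one, Complex.norm_real, Real.norm_eq_abs]
      linarith [Real.abs_cos_le_one x]
    calc ‖h x‖ ≤ ‖exp (t * x * I)‖ + ‖(1 : ℂ)‖ + ‖(t * Real.sin x * I : ℂ)‖
          + ‖(t ^ 2 * (1 - Real.cos x) : ℂ)‖ :=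
          (norm_add_le _ _).trans (add_le_add_left ((norm_sub_le _ _).trans
            (add_le_add_left (norm_sub_le _ _) _)) _)
      _ ≤ B := by rw [e1, norm_one, hB]; linarith
  -- compare with `η (1 - cos x)` near the origin and with the constant `B` away from it
  have hDle : ∀ η > 0, ‖D‖ ≤ η * (-(ψ 1).re) := by
    intro η hη
    obtain ⟨δ, hδ, hle⟩ := exists_norm_exp_sub_le_mul_one_sub_cos t hη
    have hmeas : MeasurableSet {x : ℝ | δ < |x|} := measurableSet_lt measurable_const (by fun_prop)
    have hbound : ∀ i, ‖(c i : ℂ) * ∫ x, h x ∂μ i‖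
        ≤ η * (c i * (1 - (charFun (μ i) 1).re)) + B * (c i * (μ i).real {x | δ < |x|}) := by
      intro i
      have hi1 : Integrable (fun x ↦ η * (1 - Real.cos x)) (μ i) :=
        ((integrable_const _).sub (hcosint i)).const_mul _
      have hi2 : Integrable ({x : ℝ | δ < |x|}.indicator fun _ ↦ B) (μ i) :=
        (integrable_const B).indicator hmeas
      have : ‖∫ x, h x ∂μ i‖ ≤ η * (1 - (charFun (μ i) 1).re) + B * (μ i).real {x | δ < |x|} := by
        calc ‖∫ x, h x ∂μ i‖
            ≤ ∫ x, (η * (1 - Real.cos x) + {x : ℝ | δ < |x|}.indicator (fun _ ↦ B) x) ∂μ i := by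
              refine norm_integral_le_of_norm_le (hi1.add hi2) (ae_of_all _ fun x ↦ ?_)
              by_cases hx : δ < |x|
              · rw [Set.indicator_of_mem (by exact hx)]
                have : 0 ≤ η * (1 - Real.cos x) :=
                  mul_nonneg hη.le (by linarith [Real.cos_le_one x])
                linarith [hhB x]
              · rw [Set.indicator_of_notMem (by exact hx), add_zero]
                exact hle x (not_lt.1 hx)
          _ = _ := by
              rw [integral_add hi1 hi2, integral_const_mul,
                integral_sub (integrable_const _) (hcosint i), hre,
                integral_indicator_const _ hmeas]
              simp [mul_comm]
      rw [norm_mul, Complex.norm_real, Real.norm_of_nonneg (hc i)]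
      nlinarith [hc i, mul_le_mul_of_nonneg_left this (hc i)]
    have h1 := (hlimre.const_mul η).add ((hsmall δ hδ).const_mul B)
    rw [mul_zero, add_zero] at h1
    exact le_of_tendsto_of_tendsto hlim.norm h1 (Eventually.of_forall hbound)
  have hD0 : D = 0 := by
    have h1 : Tendsto (fun η : ℝ ↦ η * (-(ψ 1).re)) (𝓝[>] 0) (𝓝 0) := by
      have : Tendsto (fun η : ℝ ↦ η * (-(ψ 1).re)) (𝓝 0) (𝓝 (0 * (-(ψ 1).re))) :=
        Continuous.tendsto (by fun_prop) 0
      rw [zero_mul] at this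
      exact this.mono_left nhdsWithin_le_nhds
    exact norm_le_zero_iff.1
      (ge_of_tendsto h1 (eventually_nhdsWithin_of_forall fun η hη ↦ hDle η hη))
  rw [hD] at hD0
  push_cast at hD0
  linear_combination hD0

/-! ### Real processes with stationary independent increments -/

open Filter Topology in
/-- If `(1 - p n) ^ n → 1` for probabilities `p n`, then `n * p n → 0`. -/
lemma tendsto_mul_zero_of_tendsto_one_sub_pow {p : ℕ → ℝ} (hp0 : ∀ n, 0 ≤ p n)
    (hp1 : ∀ n, p n ≤ 1) {N : ℕ → ℕ}
    (h : Tendsto (fun n ↦ (1 - p n) ^ N n) atTop (𝓝 1)) :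
    Tendsto (fun n ↦ (N n : ℝ) * p n) atTop (𝓝 0) := by
  have hlog : Tendsto (fun n ↦ -Real.log ((1 - p n) ^ N n)) atTop (𝓝 0) := by
    have := (h.log one_ne_zero).neg
    simpa using this
  refine squeeze_zero' (Eventually.of_forall fun n ↦ mul_nonneg (Nat.cast_nonneg _) (hp0 n)) ?_ hlog
  -- restrict to positive powers: `Real.log 0 = 0` would break the comparison below
  filter_upwards [h.eventually (lt_mem_nhds one_pos)] with n hn
  have h1 : (1 - p n) ^ N n ≤ Real.exp (-(N n * p n)) := by
    calc (1 - p n) ^ N n ≤ Real.exp (-p n) ^ N n := by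
          gcongr
          · linarith [hp1 n]
          · linarith [Real.add_one_le_exp (-p n)]
      _ = Real.exp (-(N n * p n)) := by rw [← Real.exp_nat_mul]; ring_nf
  have := Real.log_le_log hn h1
  rw [Real.log_exp] at this
  linarith

section RealProcess

variable {Ω : Type*} [MeasurableSpace Ω] {P : Measure Ω} [IsProbabilityMeasure P]
  {Y : ℝ≥0 → Ω → ℝ}

open Filter Topology in
/-- For a process with continuous paths, the largest of the increments over the `n + 1` equal
pieces of `[0, 1]` tends to zero; by independence this forces the probability of a large increment
over one piece to be `o(1 / n)`. -/
lemma tendsto_mul_measureReal_increment_gt (hmeas : ∀ τ, AEMeasurable (Y τ) P)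
    (hindep : HasIndepIncrements Y P) (hstat : HasStationaryIncrements Y P)
    (hcont : ∀ᵐ ω ∂P, Continuous (fun τ ↦ Y τ ω)) {ε : ℝ} (hε : 0 < ε) :
    Tendsto (fun n : ℕ ↦ ((n + 1 : ℕ) : ℝ) *
      (P.map (fun ω ↦ Y (1 / (n + 1 : ℕ)) ω - Y 0 ω)).real {x | ε < |x|}) atTop (𝓝 0) := by
  set T : Set ℝ := {x | |x| ≤ ε} with hT
  have hTm : MeasurableSet T := measurableSet_le (by fun_prop) measurable_const
  have hTc : {x : ℝ | ε < |x|} = Tᶜ := by ext x; simp [hT]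
  have hincr : ∀ s τ, AEMeasurable (fun ω ↦ Y s ω - Y τ ω) P := fun s τ ↦ (hmeas s).sub (hmeas τ)
  have hprob : ∀ s τ, IsProbabilityMeasure (P.map (fun ω ↦ Y s ω - Y τ ω)) := fun s τ ↦
    Measure.isProbabilityMeasure_map (hincr s τ)
  refine tendsto_mul_zero_of_tendsto_one_sub_pow (fun n ↦ measureReal_nonneg)
    (fun n ↦ measureReal_le_one) ?_
  -- the event that all `n + 1` increments are at most `ε`
  set A : ℕ → Set Ω := fun n ↦ ⋂ k ∈ Finset.range (n + 1),
    (fun ω ↦ Y ((k + 1 : ℕ) / (n + 1 : ℕ)) ω - Y (k / (n + 1 : ℕ)) ω) ⁻¹' T with hA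
  have hAnull : ∀ n, NullMeasurableSet (A n) P := fun n ↦
    NullMeasurableSet.biInter (Finset.countable_toSet _) fun k _ ↦
      (hincr _ _).nullMeasurableSet_preimage hTm
  have hPA : ∀ n, P.real (A n) =
      (1 - (P.map (fun ω ↦ Y (1 / (n + 1 : ℕ)) ω - Y 0 ω)).real {x | ε < |x|}) ^ (n + 1) := by
    intro n
    have hmono : Monotone fun k : ℕ ↦ ((k : ℝ≥0) / (n + 1 : ℕ)) := fun i j hij ↦ by
      simp only
      gcongr
    have hk : ∀ k : ℕ, P ((fun ω ↦ Y ((k + 1 : ℕ) / (n + 1 : ℕ)) ω - Y (k / (n + 1 : ℕ)) ω) ⁻¹' T)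
        = P.map (fun ω ↦ Y (1 / (n + 1 : ℕ)) ω - Y 0 ω) T := by
      intro k
      have := (hstat (1 / (n + 1 : ℕ)) (k / (n + 1 : ℕ)) 0).map_eq
      rw [← Measure.map_apply_of_aemeasurable (hincr _ _) hTm]
      rw [zero_add, ← add_div] at this
      rw [← this]
      norm_cast
    rw [hTc, probReal_compl_eq_one_sub hTm, sub_sub_cancel, measureReal_def, measureReal_def,
      ← ENNReal.toReal_pow]
    congr 1
    rw [hA]
    simp only
    rw [(hindep.nat hmono).measure_inter_preimage_eq_mul _ (fun _ _ ↦ hTm),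
      Finset.prod_congr rfl fun k _ ↦ hk k, Finset.prod_const, Finset.card_range]
  have hev : ∀ᵐ ω ∂P, ∀ᶠ n in atTop, ω ∈ A n := by
    filter_upwards [hcont] with ω hω
    have huc := (isCompact_Icc (a := (0 : ℝ≥0)) (b := 1)).uniformContinuousOn_of_continuous
      hω.continuousOn
    obtain ⟨δ, hδ, hle⟩ := Metric.uniformContinuousOn_iff_le.1 huc ε hε
    have hlim : Tendsto (fun n : ℕ ↦ (1 : ℝ) / ((n : ℝ) + 1)) atTop (𝓝 0) :=
      tendsto_one_div_add_atTop_nhds_zero_nat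
    filter_upwards [hlim.eventually (gt_mem_nhds hδ)] with n hn
    simp only [hA, Set.mem_iInter, Set.mem_preimage, Finset.mem_range]
    intro k hkn
    have hn0 : (0 : ℝ≥0) < (n + 1 : ℕ) := by positivity
    have := hle ((k + 1 : ℕ) / (n + 1 : ℕ)) ⟨zero_le, ?_⟩ (k / (n + 1 : ℕ)) ⟨zero_le, ?_⟩ ?_
    · rwa [Real.dist_eq] at this
    · rw [div_le_one hn0]; exact_mod_cast hkn
    · rw [div_le_one hn0]; exact_mod_cast hkn.le
    · rw [NNReal.dist_eq]
      push_cast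
      rw [← sub_div, add_sub_cancel_left, abs_of_nonneg (by positivity)]
      exact hn.le
  have hlim : Tendsto (fun n ↦ P.real (A n)) atTop (𝓝 1) := by
    have := tendsto_integral_of_dominated_convergence (μ := P)
      (F := fun n ↦ (A n).indicator fun _ ↦ (1 : ℝ)) (f := fun _ ↦ 1) (fun _ ↦ 1)
      (fun n ↦ (aestronglyMeasurable_const).indicator₀ (hAnull n)) (integrable_const _)
      (fun n ↦ ae_of_all _ fun ω ↦ by
        by_cases h : ω ∈ A n <;> simp [h]) (by
        filter_upwards [hev] with ω hω
        refine tendsto_const_nhds.congr' ?_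
        filter_upwards [hω] with n hn
        simp [hn])
    simp_rw [integral_indicator₀ (hAnull _)] at this
    simpa using this
  exact hlim.congr hPA

open Filter Topology Complex in
/-- A real process with stationary independent increments and continuous paths has Gaussian
increments, with mean and variance proportional to time. -/
theorem exists_map_increment_eq_gaussianReal (hmeas : ∀ τ, AEMeasurable (Y τ) P)
    (hindep : HasIndepIncrements Y P) (hstat : HasStationaryIncrements Y P)
    (hcont : ∀ᵐ ω ∂P, Continuous (fun τ ↦ Y τ ω)) :
    ∃ (m : ℝ) (v : ℝ≥0), ∀ τ : ℝ≥0,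
      P.map (fun ω ↦ Y τ ω - Y 0 ω) = gaussianReal (τ * m) (τ * v) := by
  have hincr : ∀ s τ, AEMeasurable (fun ω ↦ Y s ω - Y τ ω) P := fun s τ ↦ (hmeas s).sub (hmeas τ)
  have hprob : ∀ s τ, IsProbabilityMeasure (P.map (fun ω ↦ Y s ω - Y τ ω)) := fun s τ ↦
    Measure.isProbabilityMeasure_map (hincr s τ)
  set φ : ℝ → ℝ≥0 → ℂ := fun t τ ↦ charFun (P.map (fun ω ↦ Y τ ω - Y 0 ω)) t with hφ
  have hφmul : ∀ t s τ, φ t (s + τ) = φ t s * φ t τ := by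
    intro t s τ
    have h1 := (hindep.indepFun_sub_sub zero_le (le_self_add (a := s) (b := τ)))
    have h2 := congrFun (h1.charFun_map_add_eq_mul (hincr _ _) (hincr _ _)) t
    have h3 : (fun ω ↦ Y s ω - Y 0 ω) + (fun ω ↦ Y (s + τ) ω - Y s ω) = fun ω ↦ Y (s + τ) ω - Y 0 ω := by
      ext ω; simp
    have h4 := (hstat τ s 0).map_eq
    rw [zero_add] at h4
    rw [h3, Pi.mul_apply] at h2
    simp only [hφ]
    rw [h2, ← h4]
  have hφcont : ∀ t, Continuous (φ t) := by
    intro t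
    have : φ t = fun τ ↦ ∫ ω, exp (t * (Y τ ω - Y 0 ω : ℝ) * I) ∂P := by
      ext τ
      simp only [hφ]
      rw [charFun_apply_real, integral_map (hincr _ _) (by fun_prop)]
    rw [this]
    refine continuous_of_dominated (bound := fun _ ↦ 1) (fun τ ↦ ?_) (fun τ ↦ ?_)
      (integrable_const _) ?_
    · have := hincr τ 0
      exact AEMeasurable.aestronglyMeasurable (by fun_prop)
    · exact ae_of_all _ fun ω ↦ by rw [← ofReal_mul, norm_exp_ofReal_mul_I]
    · filter_upwards [hcont] with ω hω
      fun_prop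
  have hφ0 : ∀ t, φ t 0 = 1 := fun t ↦ by simp [hφ]
  choose ψ hψ using fun t ↦
    NNReal.exists_eq_exp_of_continuous_of_map_add (hφcont t) (hφ0 t) (hφmul t)
  -- the derivative of `exp (s * ψ t)` at `s = 0`, along `s = 1 / (n + 1)`
  have hlim : ∀ t, Tendsto (fun n : ℕ ↦ (((n + 1 : ℕ) : ℝ) : ℂ) *
      (charFun (P.map (fun ω ↦ Y (1 / (n + 1 : ℕ)) ω - Y 0 ω)) t - 1)) atTop (𝓝 (ψ t)) := by
    intro t
    have hd : HasDerivAt (fun s : ℝ ↦ exp (s * ψ t)) (exp ((0 : ℝ) * ψ t) * (1 * ψ t)) 0 :=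
      ((Complex.ofRealCLM.hasDerivAt (x := 0)).mul_const (ψ t)).cexp
    rw [ofReal_zero, zero_mul, exp_zero, one_mul, one_mul] at hd
    have hs : Tendsto (fun n : ℕ ↦ (1 : ℝ) / ((n : ℝ) + 1)) atTop (𝓝[≠] 0) :=
      tendsto_nhdsWithin_iff.2 ⟨tendsto_one_div_add_atTop_nhds_zero_nat,
        Eventually.of_forall fun n ↦ (by positivity : (1 : ℝ) / ((n : ℝ) + 1) ≠ 0)⟩
    refine ((hasDerivAt_iff_tendsto_slope_zero.1 hd).comp hs).congr fun n ↦ ?_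
    have := hψ t (1 / (n + 1 : ℕ))
    simp only [hφ] at this
    rw [this]
    simp
  have hquad : ∀ t, ψ t = t * (ψ 1).im * I + t ^ 2 * (ψ 1).re :=
    eq_linear_add_quadratic_of_tendsto_charFun (fun n ↦ by positivity) hlim
      (fun ε hε ↦ tendsto_mul_measureReal_increment_gt hmeas hindep hstat hcont hε)
  have hre : (ψ 1).re ≤ 0 := by
    have h1 : ‖φ 1 1‖ ≤ 1 := norm_charFun_le_one _
    rw [hψ, Complex.norm_exp, NNReal.coe_one, ofReal_one, one_mul, Real.exp_le_one_iff] at h1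
    exact h1
  set v : ℝ≥0 := ⟨-2 * (ψ 1).re, by linarith⟩ with hv
  have hvC : (v : ℂ) = -2 * ((ψ 1).re : ℂ) := by
    have : (v : ℝ) = -2 * (ψ 1).re := rfl
    exact_mod_cast congrArg ((↑) : ℝ → ℂ) this
  refine ⟨(ψ 1).im, v, fun τ ↦ Measure.ext_of_charFun ?_⟩
  ext t
  rw [charFun_gaussianReal]
  refine (hψ t τ).trans ?_
  rw [hquad t]
  congr 1
  push_cast
  rw [hvC]
  ring

end RealProcess

/-! ### Banach space valued processes -/

section BanachProcess

variable {Ω E : Type*} [MeasurableSpace Ω] {P : Measure Ω} [IsProbabilityMeasure P]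
  [NormedAddCommGroup E] [NormedSpace ℝ E] [MeasurableSpace E] [BorelSpace E] {X : ℝ≥0 → Ω → E}

/-- Continuous linear functionals reduce the law of the increments to the real-valued case. -/
lemma exists_map_dual_increment_eq_gaussianReal (hmeas : ∀ τ, AEMeasurable (X τ) P)
    (hindep : HasIndepIncrements X P) (hstat : HasStationaryIncrements X P)
    (hcont : ∀ᵐ ω ∂P, Continuous (fun τ ↦ X τ ω)) (L : StrongDual ℝ E) :
    ∃ (m : ℝ) (v : ℝ≥0), ∀ τ : ℝ≥0,
      P.map (fun ω ↦ L (X τ ω - X 0 ω)) = gaussianReal (τ * m) (τ * v) := by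
  simp only [map_sub]
  refine exists_map_increment_eq_gaussianReal (Y := fun τ ω ↦ L (X τ ω))
    (fun τ ↦ L.continuous.measurable.comp_aemeasurable (hmeas τ)) (hindep.map L) ?_ ?_
  · intro s τ τ'
    have := (hstat s τ τ').comp L.continuous.measurable
    simpa only [Function.comp_def, map_sub] using this
  · filter_upwards [hcont] with ω hω
    fun_prop

variable [SecondCountableTopology E]

lemma hasGaussianLaw_increment (hmeas : ∀ τ, AEMeasurable (X τ) P)
    (hindep : HasIndepIncrements X P) (hstat : HasStationaryIncrements X P)
    (hcont : ∀ᵐ ω ∂P, Continuous (fun τ ↦ X τ ω)) (τ : ℝ≥0) :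
    HasGaussianLaw (fun ω ↦ X τ ω - X 0 ω) P where
  isGaussian_map := by
    refine isGaussian_of_map_eq_gaussianReal fun L ↦ ?_
    obtain ⟨m, v, h⟩ :=
      exists_map_dual_increment_eq_gaussianReal hmeas hindep hstat hcont L
    refine ⟨τ * m, τ * v, ?_⟩
    have hm : AEMeasurable (fun ω ↦ X τ ω - X 0 ω) P := (hmeas τ).sub (hmeas 0)
    rw [← h τ, AEMeasurable.map_map_of_aemeasurable (by fun_prop) hm]
    rfl

variable [CompleteSpace E]

lemma covarianceBilinDual_map_apply {Z : Ω → E} (hZ : MemLp Z 2 P) (L M : StrongDual ℝ E) :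
    covarianceBilinDual (P.map Z) L M = cov[fun ω ↦ L (Z ω), fun ω ↦ M (Z ω); P] := by
  have hm : AEMeasurable Z P := hZ.aestronglyMeasurable.aemeasurable
  have : IsProbabilityMeasure (P.map Z) := Measure.isProbabilityMeasure_map hm
  have hid : MemLp id 2 (P.map Z) :=
    (memLp_map_measure_iff aestronglyMeasurable_id hm).2 hZ
  rw [covarianceBilinDual_eq_covariance hid,
    covariance_map_fun (by fun_prop) (by fun_prop) hm]

lemma covarianceBilinDual_map_sub_const {Z : Ω → E} (hZ : MemLp Z 2 P) (c : E) :
    covarianceBilinDual (P.map fun ω ↦ Z ω - c) = covarianceBilinDual (P.map Z) := by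
  ext L M
  have hint : ∀ L : StrongDual ℝ E, Integrable (fun ω ↦ L (Z ω)) P := fun L ↦
    L.integrable_comp (hZ.integrable one_le_two)
  have hZc : MemLp (fun ω ↦ Z ω - c) 2 P := hZ.sub (memLp_const c)
  rw [covarianceBilinDual_map_apply hZc, covarianceBilinDual_map_apply hZ]
  simp only [map_sub]
  rw [covariance_sub_const_left (hint L), covariance_sub_const_right (hint M)]

/-- The mean of an increment is proportional to the elapsed time. -/
lemma integral_increment (hmeas : ∀ τ, AEMeasurable (X τ) P)
    (hindep : HasIndepIncrements X P) (hstat : HasStationaryIncrements X P)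
    (hcont : ∀ᵐ ω ∂P, Continuous (fun τ ↦ X τ ω)) (τ : ℝ≥0) :
    ∫ ω, (X τ ω - X 0 ω) ∂P = (τ : ℝ) • ∫ ω, (X 1 ω - X 0 ω) ∂P := by
  refine (SeparatingDual.eq_iff_forall_dual_eq (R := ℝ)).2 fun L ↦ ?_
  obtain ⟨m, v, h⟩ := exists_map_dual_increment_eq_gaussianReal hmeas hindep hstat hcont L
  have hL : ∀ s, L (∫ ω, (X s ω - X 0 ω) ∂P) = s * m := fun s ↦ by
    have hG := hasGaussianLaw_increment hmeas hindep hstat hcont s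
    rw [← L.integral_comp_comm hG.integrable, ← integral_id_gaussianReal (μ := s * m) (v := s * v),
      ← h s, integral_map (hG.map_fun L).aemeasurable (by fun_prop)]
  rw [map_smul, hL, hL, NNReal.coe_one, one_mul, smul_eq_mul]

/-- The covariance of an increment is proportional to the elapsed time. -/
lemma covarianceBilinDual_increment (hmeas : ∀ τ, AEMeasurable (X τ) P)
    (hindep : HasIndepIncrements X P) (hstat : HasStationaryIncrements X P)
    (hcont : ∀ᵐ ω ∂P, Continuous (fun τ ↦ X τ ω)) (τ : ℝ≥0) :
    covarianceBilinDual (P.map fun ω ↦ X τ ω - X 0 ω)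
      = (τ : ℝ) • covarianceBilinDual (P.map fun ω ↦ X 1 ω - X 0 ω) := by
  have hdiag : ∀ L, covarianceBilinDual (P.map fun ω ↦ X τ ω - X 0 ω) L L
      = τ * covarianceBilinDual (P.map fun ω ↦ X 1 ω - X 0 ω) L L := by
    intro L
    obtain ⟨m, v, h⟩ := exists_map_dual_increment_eq_gaussianReal hmeas hindep hstat hcont L
    have hL : ∀ s, covarianceBilinDual (P.map fun ω ↦ X s ω - X 0 ω) L L = s * v := fun s ↦ by
      have hG := hasGaussianLaw_increment hmeas hindep hstat hcont s
      have hm := (hG.map_fun L).aemeasurable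
      rw [covarianceBilinDual_map_apply hG.memLp_two, covariance_self hm,
        ← Function.id_comp (fun ω ↦ L (X s ω - X 0 ω)), ← variance_map (by fun_prop) hm, h s,
        variance_id_gaussianReal, NNReal.coe_mul]
    rw [hL, hL, NNReal.coe_one, one_mul]
  -- two symmetric forms with the same diagonal are equal
  ext L M
  have h := hdiag (L + M)
  simp only [map_add, add_apply, hdiag L, hdiag M,
    covarianceBilinDual_comm M L] at h
  simp only [smul_apply, smul_eq_mul]
  linarith

/-- Two increments from time `0` share the increment over the shorter interval, and the rest is
independent of it. -/
lemma covariance_increment_of_le (hmeas : ∀ τ, AEMeasurable (X τ) P)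
    (hindep : HasIndepIncrements X P) (hstat : HasStationaryIncrements X P)
    (hcont : ∀ᵐ ω ∂P, Continuous (fun τ ↦ X τ ω)) {σ τ : ℝ≥0} (hστ : σ ≤ τ)
    (L M : StrongDual ℝ E) :
    cov[fun ω ↦ L (X σ ω - X 0 ω), fun ω ↦ M (X τ ω - X 0 ω); P]
      = σ * covarianceBilinDual (P.map fun ω ↦ X 1 ω - X 0 ω) L M := by
  have hmem := fun s ↦ (hasGaussianLaw_increment hmeas hindep hstat hcont s).memLp_two
  have hmemL : ∀ (K : StrongDual ℝ E) s, MemLp (fun ω ↦ K (X s ω - X 0 ω)) 2 P := fun K s ↦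
    ((hasGaussianLaw_increment hmeas hindep hstat hcont s).map_fun K).memLp_two
  have hsplit : (fun ω ↦ M (X τ ω - X 0 ω))
      = (fun ω ↦ M (X σ ω - X 0 ω)) + fun ω ↦ M (X τ ω - X σ ω) := by
    ext ω
    simp
  have hmem' : MemLp (fun ω ↦ M (X τ ω - X σ ω)) 2 P := by
    convert (hmemL M τ).sub (hmemL M σ) using 1
    ext ω
    simp
  have hind : (fun ω ↦ L (X σ ω - X 0 ω)) ⟂ᵢ[P] (fun ω ↦ M (X τ ω - X σ ω)) :=
    (hindep.indepFun_sub_sub zero_le hστ).comp L.continuous.measurable M.continuous.measurable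
  rw [hsplit, covariance_add_right (hmemL L σ) (hmemL M σ) hmem',
    hind.covariance_eq_zero (hmemL L σ) hmem', add_zero,
    ← covarianceBilinDual_map_apply (hmem σ),
    covarianceBilinDual_increment hmeas hindep hstat hcont σ]
  rfl

end BanachProcess

theorem theoremD {Ω E : Type*} [MeasurableSpace Ω] (P : Measure Ω) [IsProbabilityMeasure P]
    [NormedAddCommGroup E] [NormedSpace ℝ E] [CompleteSpace E] [SecondCountableTopology E]
    [MeasurableSpace E] [BorelSpace E]
    (X : ℝ≥0 → Ω → E)
    (hmeas : ∀ τ, AEMeasurable (X τ) P)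
    (hindep : HasIndepIncrements X P)
    (hstat : HasStationaryIncrements X P)
    (hcont : ∀ᵐ ω ∂P, Continuous (fun τ ↦ X τ ω)) :
    ∃ (b : E) (A : StrongDual ℝ E →L[ℝ] StrongDual ℝ E →L[ℝ] ℝ),
      A.toBilinForm.IsPosSemidef ∧
      IsGaussianProcess (fun τ ω ↦ X τ ω - X 0 ω) P ∧
      (∀ τ : ℝ≥0, MemLp (fun ω ↦ X τ ω - X 0 ω) 2 P) ∧
      (∀ τ : ℝ≥0, ∫ ω, (X τ ω - X 0 ω) ∂P = (τ : ℝ) • b) ∧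
      (∀ (σ τ : ℝ≥0) (L M : StrongDual ℝ E),
        cov[fun ω ↦ L (X σ ω - X 0 ω), fun ω ↦ M (X τ ω - X 0 ω); P]
          = min (σ : ℝ) (τ : ℝ) * A L M) ∧
      IsWienerProcess (fun τ ω ↦ X τ ω - X 0 ω - (τ : ℝ) • b) A P := by
  have hG := hasGaussianLaw_increment hmeas hindep hstat hcont
  have hmean := integral_increment hmeas hindep hstat hcont
  set b : E := ∫ ω, (X 1 ω - X 0 ω) ∂P
  set A := covarianceBilinDual (P.map fun ω ↦ X 1 ω - X 0 ω)
  have hWincr : ∀ s t : ℝ≥0, (fun ω ↦ (X t ω - X 0 ω - (t : ℝ) • b) - (X s ω - X 0 ω - (s : ℝ) • b))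
      = fun ω ↦ (X t ω - X s ω) - ((t : ℝ) - s) • b := fun s t ↦ by
    ext ω
    rw [sub_smul]
    abel
  have hid : ∀ s t : ℝ≥0, s ≤ t → IdentDistrib (fun ω ↦ X t ω - X s ω)
      (fun ω ↦ X (t - s) ω - X 0 ω) P P := fun s t hst ↦ by
    have := hstat (t - s) s 0
    rwa [zero_add, add_tsub_cancel_of_le hst] at this
  have hGincr : ∀ s t : ℝ≥0, s ≤ t → HasGaussianLaw (fun ω ↦ X t ω - X s ω) P := fun s t hst ↦
    ⟨by rw [(hid s t hst).map_eq]; exact (hG _).isGaussian_map⟩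
  refine ⟨b, A, isPosSemidef_covarianceBilinDual, ?_, fun τ ↦ (hG τ).memLp_two, hmean, ?_, ?_⟩
  · refine HasIndepIncrements.isGaussianProcess hG (by simp) fun n t ht ↦ ?_
    simpa only [sub_sub_sub_cancel_right] using hindep n t ht
  · intro σ τ L M
    rcases le_total σ τ with h | h
    · rw [covariance_increment_of_le hmeas hindep hstat hcont h, min_eq_left (by exact_mod_cast h)]
    · rw [covariance_comm, covariance_increment_of_le hmeas hindep hstat hcont h,
        min_eq_right (by exact_mod_cast h), covarianceBilinDual_comm]
  · exact
    { posSemidef := isPosSemidef_covarianceBilinDual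
      zero := by simp
      gaussian_increments := fun s t hst ↦ by
        rw [hWincr]
        constructor
        have := (hGincr s t hst).isGaussian_map
        have h := AEMeasurable.map_map_of_aemeasurable (μ := P) (f := fun ω ↦ X t ω - X s ω)
          (g := fun x ↦ x - ((t : ℝ) - s) • b) (by fun_prop) (hGincr s t hst).aemeasurable
        rw [Function.comp_def] at h
        rw [← h]
        infer_instance
      mean_increments := fun s t hst ↦ by
        rw [hWincr, integral_sub (hGincr s t hst).integrable (integrable_const _),
          (hid s t hst).integral_eq, hmean, NNReal.coe_sub hst]
        simp
      covariance_increments := fun s t hst ↦ by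
        rw [hWincr, covarianceBilinDual_map_sub_const (hGincr s t hst).memLp_two,
          (hid s t hst).map_eq, covarianceBilinDual_increment hmeas hindep hstat hcont,
          NNReal.coe_sub hst]
      independent_increments := fun n t ht ↦ by
        have h := (hindep n t ht).comp
          (fun i x ↦ x - (((t i.succ : ℝ≥0) : ℝ) - (t i.castSucc : ℝ≥0)) • b)
          (fun i ↦ by fun_prop)
        convert h using 2 with i
        exact hWincr (t i.castSucc) (t i.succ)
      continuous_paths := by
        filter_upwards [hcont] with ω hω
        fun_prop }
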